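/- Let $(X,\mathrm{dist})$ be a metric space. For finite nonempty $C\subseteq X$ put $\mathrm{dist}(x,C)=\min_{y\in C}\mathrm{dist}(x,y)$. For a finite set $P\subseteq X$ with weights $w_P:P\to\mathbb R_{+}$ put $\mathrm{cost}_z(P,C)=\sum_{x\in P}w_P(x)\,\mathrm{dist}(x,C)^z$; an unweighted set has unit weights, and $\mathrm{cost}_z(P,c):=\mathrm{cost}_z(P,\{c\})$. A weighted subset $S\subseteq P$ is an $(\epsilon,B)$-coreset for $(k,z)$-Clustering on $P$ if $|\mathrm{cost}_z(P,C)-\mathrm{cost}_z(S,C)|\le\epsilon\,(\mathrm{cost}_z(P,C)+B)$ for every nonempty $C\subseteq X$ with $|C|\le k$. Let $\mathrm{ring}(c,a,b)=\{x\in X: a<\mathrm{dist}(x,c)\le b\}$. For a finite set $\mathcal F$ of functions $X\to\mathbb R_{+}$ let $B_{\mathcal F}(y,\rho)=\{f\in\mathcal F: f(y)\le\rho\}$, and let $\mathrm{sdim}(\mathcal F)$ be the smallest integer $t\ge1$ such that $|\{B_{\mathcal F}(y,\rho)\cap\mathcal H: y\in X,\ \rho\ge0\}|\le|\mathcal H|^{t}$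 for all $\mathcal H\subseteq\mathcal F$ with $|\mathcal H|\ge2$. **Theorem.** There is an absolute constant $p\in\mathbb N$, and for every $z>0$ there are constants $A_z\ge1$ and $K_z>0$ depending only on $z$, with $A_z=1$ whenever $z\le1$, such that the following holds. Let $(X,\mathrm{dist})$ be a metric space, $c\in X$, $r>0$, $R\subseteq\mathrm{ring}(c,r,2r)$ finite, $0<\epsilon,\delta<1$, and $k\ge1$ an integer. Let $\mathcal F=\{f_x:X\to\mathbb R_{+}\}_{x\in R}$ satisfy $$\mathrm{dist}(x,y)\le f_x(y)\le\Bigl(1+\frac{\epsilon}{A_z}\Bigr)\mathrm{dist}(x,y)\qquad\text{for all }x\in R,\ y\in X .$$ Let $m$ be any integer with $$m\ \ge\ K_z\,\epsilon^{-2}\,\log^{p}\!\Bigl(\frac{2k\,\mathrm{sdim}(\mathcal F)}{\epsilon}\Bigr)\cdot k\,\log\frac{2}{\delta}\cdot\mathrm{sdim}(\mathcal F),$$ and let $S$ be a uniformly random subset of $R$ of size $\min(m,|R|)$, each point of which is given the weight $|R|/|S|$. Then with probability at least $1-\delta$, $S$ is an $(\epsilon,\mathrm{cost}_z(R,c))$-coreset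 for $(k,z)$-Clustering on $R$. -/

import Mathlib

open scoped NNReal

noncomputable section

namespace UniformCoreset

variable {X : Type*}

/-- The ring `ring(u, a, b)`: the points `x` with `a < dist(x, u) ≤ b`. -/
def ring [MetricSpace X] (u : X) (a b : ℝ) : Set X :=
  {x | a < dist x u ∧ dist x u ≤ b}

/-- The cost `cost_z(P, C) = ∑_{x ∈ P} w(x) · dist(x, C)^z` of the finite set `P` weighted by `w`.
It is only used for nonempty finite `C`, where `Metric.infDist x C` is the minimum of
`dist x c` over `c ∈ C`. -/
def cost [MetricSpace X] (z : ℝ) (P : Finset X) (w : X → ℝ) (C : Finset X) : ℝ :=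
  ∑ x ∈ P, w x * (Metric.infDist x (C : Set X)) ^ z

/-- The unit weight function, with which an unweighted set is identified. -/
def unitWeight : X → ℝ := fun _ => 1

/-- `S`, weighted by `w`, is an `(ε, A)`-coreset for `(k, z)`-clustering on the unweighted set `P`:
it is a subset of `P`, and for all sets `C` of at most `k` centers its cost differs from
that of `P` by at most `ε · (cost_z(P, C) + A)`. -/
def IsCoreset [MetricSpace X] (k : ℕ) (z ε A : ℝ) (P S : Finset X) (w : X → ℝ) : Prop :=
  S ⊆ P ∧ ∀ C : Finset X, C.Nonempty → C.card ≤ k →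
    |cost z P unitWeight C - cost z S w C| ≤ ε * (cost z P unitWeight C + A)

/-- The ball `B_F(c, r)`: the functions `f ∈ F` with `f(c) ≤ r`. -/
def fball (F : Set (X → ℝ≥0)) (c : X) (r : ℝ≥0) : Set (X → ℝ≥0) :=
  {f | f ∈ F ∧ f c ≤ r}

/-- The traces `{B_F(c, r) ∩ H : c ∈ X, r ≥ 0}` of the balls on a finite set `H` of functions. -/
def traces (F : Set (X → ℝ≥0)) (H : Finset (X → ℝ≥0)) : Set (Set (X → ℝ≥0)) :=
  {G | ∃ (c : X) (r : ℝ≥0), G = fball F c r ∩ (H : Set (X → ℝ≥0))}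

/-- The shattering dimension of a finite set `F` of functions: the least integer `t ≥ 1` such that
every `H ⊆ F` with `|H| ≥ 2` has at most `|H|^t` traces. (For finite `F` such a `t` exists.) -/
def sdim (F : Set (X → ℝ≥0)) : ℕ :=
  sInf {t : ℕ | 1 ≤ t ∧ ∀ H : Finset (X → ℝ≥0), (H : Set (X → ℝ≥0)) ⊆ F → 2 ≤ H.card →
    (traces F H).ncard ≤ H.card ^ t}

open Classical in
/-- The probability that a uniformly random `m`-element subset `S` of `R` satisfies `E`
(meaningful for `m ≤ |R|`). -/
def uniformSampleProb (R : Finset X) (m : ℕ) (E : Finset X → Prop) : ℝ :=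
  (((R.powersetCard m).filter E).card : ℝ) / ((R.powersetCard m).card : ℝ)

end UniformCoreset

end

noncomputable section

namespace UniformCoreset

open Finset

/-! ### Concentration for sampling without replacement. -/

section Hypergeometric

variable {α : Type*} [DecidableEq α]

/-! For a fixed center set `C`, the function `g x = min_{y ∈ C} f_x(y)` approximates the distance to
`C`, and its sublevel sets in `R` are unions of at most `k` balls of functions. If `S` represents
the relative sizes of all these sets, integrating over the threshold shows that it represents the
average of `g ^ z`, hence up to distortion that of the distance (`isCoreset_of_isApprox`). On the
ring, distances to `C` differ by at most `4 * r` and `|R| * r ^ z` is at most the cost of `c`, so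
the error fits the allowed bound.

Such unions have at most `|H| ^ (sdim * k)` traces on `H` (`hasGrowth_centerRanges`). A direct union
bound would bring in `log |R|`; sampling through nested samples of sizes `n ^ 2`, `n ^ 4`, ...
avoids this (`card_filter_not_isApprox_le_mul`), each stage using the hypergeometric tail bound
`card_filter_deviation_le`. What remains is to absorb `log m` into `m` (`sample_size_sufficient`).
-/

theorem sum_powersetCard_powersetCard (R : Finset α) {n M : ℕ} (hnM : n ≤ M)
    (g : Finset α → ℝ) :
    ∑ T ∈ R.powersetCard M, ∑ S ∈ T.powersetCard n, g S
      = ((R.card - n).choose (M - n) : ℝ) * ∑ S ∈ R.powersetCard n, g S := by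
  have h1 : ∀ T ∈ R.powersetCard M, ∑ S ∈ T.powersetCard n, g S
      = ∑ S ∈ R.powersetCard n, if S ⊆ T then g S else 0 := by
    intro T hT
    rw [← sum_filter]
    refine sum_congr ?_ fun _ _ => rfl
    ext S
    simp only [mem_powersetCard, mem_filter] at hT ⊢
    constructor
    · rintro ⟨a, b⟩
      exact ⟨⟨a.trans hT.1, b⟩, a⟩
    · rintro ⟨⟨_, b⟩, a⟩
      exact ⟨a, b⟩
  rw [sum_congr rfl h1, sum_comm, mul_sum]
  refine sum_congr rfl fun S hS => ?_
  rw [mem_powersetCard] at hS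
  rw [← sum_filter, sum_const, nsmul_eq_mul, card_filter_powersetCard_subset _ _ _ hS.1
    (by omega), hS.2]

/-- Double counting of the pairs `J ⊆ S` with `J ⊆ A` and `|J| = j`; this gives the factorial
moments of the hypergeometric law. -/
theorem sum_choose_card_inter (R A : Finset α) (hA : A ⊆ R) {j m : ℕ} (hjm : j ≤ m) :
    ∑ S ∈ R.powersetCard m, ((S ∩ A).card.choose j : ℝ)
      = (A.card.choose j : ℝ) * ((R.card - j).choose (m - j) : ℝ) := by
  have h := sum_powersetCard_powersetCard R hjm (fun J => if J ⊆ A then (1 : ℝ) else 0)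
  have h2 : ∀ S : Finset α, ∑ J ∈ S.powersetCard j, (if J ⊆ A then (1 : ℝ) else 0)
      = ((S ∩ A).card.choose j : ℝ) := by
    intro S
    rw [← sum_filter, sum_const, nsmul_eq_mul, mul_one, ← card_powersetCard]
    congr 2
    ext J
    simp only [mem_filter, mem_powersetCard, subset_inter_iff]
    tauto
  simp only [h2] at h
  rw [h, inter_eq_right.2 hA, mul_comm]

/-- Factor by factor, `(a - i) / (N - i) ≤ a / N`. -/
theorem choose_mul_pow_le {a N : ℕ} (h : a ≤ N) (j : ℕ) :
    a.choose j * N ^ j ≤ N.choose j * a ^ j := by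
  have h1 : a.descFactorial j * N ^ j ≤ N.descFactorial j * a ^ j := by
    induction j with
    | zero => simp
    | succ j ih =>
      rw [Nat.descFactorial_succ, Nat.descFactorial_succ, pow_succ, pow_succ]
      have h2 : (a - j) * N ≤ (N - j) * a := by
        rw [Nat.sub_mul, Nat.sub_mul, mul_comm N a]
        have := Nat.mul_le_mul_left j h
        omega
      calc (a - j) * a.descFactorial j * (N ^ j * N)
          = ((a - j) * N) * (a.descFactorial j * N ^ j) := by ring
        _ ≤ ((N - j) * a) * (N.descFactorial j * a ^ j) := Nat.mul_le_mul h2 ih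
        _ = _ := by ring
  rw [Nat.descFactorial_eq_factorial_mul_choose, Nat.descFactorial_eq_factorial_mul_choose,
    mul_assoc, mul_assoc] at h1
  exact Nat.le_of_mul_le_mul_left h1 (Nat.factorial_pos j)

/-- The generating function of a hypergeometric variable is at most that of the binomial variable
with the same number of draws and the same mean. -/
theorem sum_one_add_pow_card_inter_le (R A : Finset α) (hA : A ⊆ R) (hR : R.Nonempty) (m : ℕ)
    {u : ℝ} (hu : 0 ≤ u) :
    ∑ S ∈ R.powersetCard m, (1 + u) ^ (S ∩ A).card
      ≤ (R.card.choose m : ℝ) * (1 + u * ((A.card : ℝ) / R.card)) ^ m := by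
  have hN : (0 : ℝ) < R.card := by exact_mod_cast hR.card_pos
  have h1 : ∀ S ∈ R.powersetCard m, (1 + u) ^ (S ∩ A).card
      = ∑ j ∈ range (m + 1), u ^ j * ((S ∩ A).card.choose j : ℝ) := by
    intro S hS
    rw [mem_powersetCard] at hS
    have hle : (S ∩ A).card ≤ m := hS.2 ▸ card_le_card inter_subset_left
    rw [add_comm 1 u, add_pow]
    simp only [one_pow, mul_one]
    -- The added binomial coefficients vanish; a range independent of `S` allows the sums to be
    -- exchanged.
    refine sum_subset (range_mono (by omega)) fun j _ hj => ?_
    rw [mem_range, not_lt] at hj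
    rw [Nat.choose_eq_zero_of_lt (by omega)]
    simp
  rw [sum_congr rfl h1, sum_comm, add_comm 1, add_pow, mul_sum]
  refine sum_le_sum fun j hj => ?_
  rw [mem_range] at hj
  rw [← mul_sum, sum_choose_card_inter R A hA (by omega), one_pow, mul_one, mul_pow, div_pow]
  have hid : (R.card.choose m : ℝ) * (m.choose j : ℝ)
      = (R.card.choose j : ℝ) * ((R.card - j).choose (m - j) : ℝ) := by
    exact_mod_cast Nat.choose_mul (by omega)
  have hc : (A.card.choose j : ℝ) ≤ (R.card.choose j : ℝ) * ((A.card : ℝ) ^ j / (R.card : ℝ) ^ j) := by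
    rw [← mul_div_assoc, le_div_iff₀ (by positivity)]
    exact_mod_cast choose_mul_pow_le (card_le_card hA) j
  calc u ^ j * ((A.card.choose j : ℝ) * ((R.card - j).choose (m - j) : ℝ))
      ≤ u ^ j * ((R.card.choose j : ℝ) * ((A.card : ℝ) ^ j / (R.card : ℝ) ^ j)
          * ((R.card - j).choose (m - j) : ℝ)) := by gcongr
    _ = u ^ j * ((A.card : ℝ) ^ j / (R.card : ℝ) ^ j) * ((R.card.choose j : ℝ)
          * ((R.card - j).choose (m - j) : ℝ)) := by ring
    _ = _ := by rw [← hid]; ring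

/-- Chernoff's method with parameter `l = η / 2`, which minimizes `l ^ 2 - l * η`. -/
theorem card_filter_upper_tail_le (R A : Finset α) (hA : A ⊆ R) (hR : R.Nonempty) (m : ℕ)
    {η : ℝ} (hη : 0 ≤ η) (hη1 : η ≤ 1) :
    (((R.powersetCard m).filter
      (fun S => (m : ℝ) * ((A.card : ℝ) / R.card + η) ≤ ((S ∩ A).card : ℝ))).card : ℝ)
      ≤ (R.card.choose m : ℝ) * Real.exp (-(m * η ^ 2 / 4)) := by
  have hN : (0 : ℝ) < R.card := by exact_mod_cast hR.card_pos
  set p : ℝ := (A.card : ℝ) / R.card with hp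
  have hp0 : 0 ≤ p := by positivity
  have hp1 : p ≤ 1 := by
    rw [hp, div_le_one hN]
    exact_mod_cast card_le_card hA
  set l : ℝ := η / 2 with hl
  have hexp : Real.exp l ≤ 1 + l + l ^ 2 := by
    have := abs_le.1 (Real.abs_exp_sub_one_sub_id_le (x := l) (by rw [abs_le]; constructor <;> linarith))
    linarith
  have hu : 0 ≤ Real.exp l - 1 := by
    have := Real.add_one_le_exp l
    linarith
  have h1 := sum_one_add_pow_card_inter_le R A hA hR m hu
  rw [← hp] at h1
  have h2 : (1 + (Real.exp l - 1) * p) ^ m ≤ Real.exp (m * (p * l + l ^ 2)) := by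
    rw [Real.exp_nat_mul]
    refine pow_le_pow_left₀ (by positivity) ?_ m
    refine le_trans ?_ (Real.add_one_le_exp _)
    nlinarith [sq_nonneg l]
  set B := (R.powersetCard m).filter (fun S => (m : ℝ) * (p + η) ≤ ((S ∩ A).card : ℝ))
  have h3 : (B.card : ℝ) * Real.exp (l * (m * (p + η)))
      ≤ ∑ S ∈ R.powersetCard m, (1 + (Real.exp l - 1)) ^ (S ∩ A).card := by
    rw [← nsmul_eq_mul, ← sum_const]
    refine (sum_le_sum fun S hS => ?_).trans
      (sum_le_sum_of_subset_of_nonneg (filter_subset _ _) fun S _ _ => by positivity)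
    rw [mem_filter] at hS
    rw [add_sub_cancel, ← Real.exp_nat_mul]
    refine Real.exp_le_exp.2 ?_
    rw [mul_comm _ l]
    exact mul_le_mul_of_nonneg_left hS.2 (by positivity)
  have h4 : (B.card : ℝ) * Real.exp (l * (m * (p + η)))
      ≤ (R.card.choose m : ℝ) * Real.exp (m * (p * l + l ^ 2)) :=
    h3.trans (h1.trans (by gcongr))
  have h5 : Real.exp (m * (p * l + l ^ 2))
      = Real.exp (-(m * η ^ 2 / 4)) * Real.exp (l * (m * (p + η))) := by
    rw [← Real.exp_add]
    congr 1
    rw [hl]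
    ring
  rw [h5, ← mul_assoc (R.card.choose m : ℝ)] at h4
  exact le_of_mul_le_mul_right h4 (Real.exp_pos _)

/-- The lower tail for `A` is the upper tail for `R \ A`. -/
theorem card_filter_deviation_le (R A : Finset α) (hA : A ⊆ R) {m : ℕ} (hm0 : 0 < m)
    (hm : m ≤ R.card) {η : ℝ} (hη : 0 ≤ η) (hη1 : η ≤ 1) :
    (((R.powersetCard m).filter
      (fun S => η < |(A.card : ℝ) / R.card - ((S ∩ A).card : ℝ) / m|)).card : ℝ)
      ≤ 2 * ((R.card.choose m : ℝ) * Real.exp (-(m * η ^ 2 / 4))) := by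
  have hR : R.Nonempty := card_pos.1 (by omega)
  have hN : (0 : ℝ) < R.card := by exact_mod_cast hR.card_pos
  have hm' : (0 : ℝ) < m := by exact_mod_cast hm0
  have h1 := card_filter_upper_tail_le R A hA hR m hη hη1
  have h2 := card_filter_upper_tail_le R (R \ A) sdiff_subset hR m hη hη1
  have hsub : (R.powersetCard m).filter
      (fun S => η < |(A.card : ℝ) / R.card - ((S ∩ A).card : ℝ) / m|)
      ⊆ (R.powersetCard m).filter
          (fun S => (m : ℝ) * ((A.card : ℝ) / R.card + η) ≤ ((S ∩ A).card : ℝ))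
        ∪ (R.powersetCard m).filter
          (fun S => (m : ℝ) * (((R \ A).card : ℝ) / R.card + η) ≤ ((S ∩ (R \ A)).card : ℝ)) := by
    intro S hS
    rw [mem_filter, mem_powersetCard] at hS
    obtain ⟨⟨hSR, hSm⟩, hS⟩ := hS
    rw [← filter_or, mem_filter]
    refine ⟨mem_powersetCard.2 ⟨hSR, hSm⟩, ?_⟩
    rcases lt_abs.1 hS with h | h
    · right
      have e1 : ((S ∩ (R \ A)).card : ℝ) = m - (S ∩ A).card := by
        have e : S ∩ (R \ A) = S \ A := by
          ext x
          simp only [mem_inter, mem_sdiff]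
          exact ⟨fun h => ⟨h.1, h.2.2⟩, fun h => ⟨h.1, hSR h.1, h.2⟩⟩
        have := card_sdiff_add_card_inter S A
        rw [e, eq_sub_iff_add_eq, ← hSm]
        exact_mod_cast this
      have e2 : ((R \ A).card : ℝ) = R.card - A.card := by
        have := card_sdiff_add_card_inter R A
        rw [inter_eq_right.2 hA] at this
        rw [eq_sub_iff_add_eq]
        exact_mod_cast this
      rw [e1, e2, sub_div, div_self hN.ne']
      have : ((S ∩ A).card : ℝ) = m * (((S ∩ A).card : ℝ) / m) := by field_simp
      rw [this]
      nlinarith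
    · left
      have : ((S ∩ A).card : ℝ) = m * (((S ∩ A).card : ℝ) / m) := by field_simp
      rw [this]
      nlinarith
  have h3 := Nat.cast_le (α := ℝ).2 ((card_le_card hsub).trans (card_union_le _ _))
  push_cast at h3
  linarith

end Hypergeometric

/-! ### Uniform convergence over range spaces of polynomial growth. -/

section RangeSpace

variable {α : Type*}

open Classical in
/-- `S` represents the relative size of every range in `𝒬` up to an additive error `η`. -/
def IsApprox (𝒬 : Set (Set α)) (η : ℝ) (R S : Finset α) : Prop :=
  ∀ A ∈ 𝒬, |((R.filter (· ∈ A)).card : ℝ) / R.card - ((S.filter (· ∈ A)).card : ℝ) / S.card| ≤ η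

open Classical in
/-- Every `H ⊆ R` with at least two elements has at most `|H| ^ d` traces of ranges in `𝒬`. -/
def HasGrowth (𝒬 : Set (Set α)) (R : Finset α) (d : ℕ) : Prop :=
  ∀ H ⊆ R, 2 ≤ H.card → ((fun A : Set α => H.filter (· ∈ A)) '' 𝒬).ncard ≤ H.card ^ d

theorem HasGrowth.mono {𝒬 : Set (Set α)} {R T : Finset α} {d : ℕ} (h : HasGrowth 𝒬 R d)
    (hT : T ⊆ R) : HasGrowth 𝒬 T d :=
  fun H hH => h H (hH.trans hT)

theorem IsApprox.trans {𝒬 : Set (Set α)} {η θ : ℝ} {R T S : Finset α} (h : IsApprox 𝒬 η R T)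
    (h' : IsApprox 𝒬 θ T S) : IsApprox 𝒬 (η + θ) R S := fun A hA =>
  (abs_sub_le _ _ _).trans (add_le_add (h A hA) (h' A hA))

open Classical in
-- Only the trace of a range on `R` matters, so a union bound over at most `|R| ^ d` traces
-- suffices.
theorem card_filter_not_isApprox_le {𝒬 : Set (Set α)} {R : Finset α} {d : ℕ}
    (h : HasGrowth 𝒬 R d) (hR : 2 ≤ R.card) {n : ℕ} (hn : 0 < n) (hnR : n ≤ R.card) {η : ℝ}
    (hη : 0 ≤ η) (hη1 : η ≤ 1) :
    (((R.powersetCard n).filter (fun S => ¬ IsApprox 𝒬 η R S)).card : ℝ)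
      ≤ (R.card : ℝ) ^ d * (2 * ((R.card.choose n : ℝ) * Real.exp (-(n * η ^ 2 / 4)))) := by
  have hfin : ((fun A : Set α => R.filter (· ∈ A)) '' 𝒬).Finite :=
    (R.powerset : Set (Finset α)).toFinite.subset (by
      rintro _ ⟨A, _, rfl⟩
      exact mem_coe.2 (mem_powerset.2 (filter_subset _ _)))
  have hsub : (R.powersetCard n).filter (fun S => ¬ IsApprox 𝒬 η R S) ⊆
      hfin.toFinset.biUnion fun A => (R.powersetCard n).filter
        (fun S => η < |(A.card : ℝ) / R.card - ((S ∩ A).card : ℝ) / n|) := by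
    intro S hS
    rw [mem_filter, mem_powersetCard, IsApprox] at hS
    obtain ⟨hSR, hS⟩ := hS
    push Not at hS
    obtain ⟨A, hA, hS⟩ := hS
    rw [mem_biUnion]
    refine ⟨R.filter (· ∈ A), hfin.mem_toFinset.2 ⟨A, hA, rfl⟩, ?_⟩
    rw [mem_filter, mem_powersetCard]
    refine ⟨hSR, ?_⟩
    rwa [inter_filter, inter_eq_left.2 hSR.1, ← hSR.2]
  have h1 : (((R.powersetCard n).filter (fun S => ¬ IsApprox 𝒬 η R S)).card : ℝ)
      ≤ ∑ A ∈ hfin.toFinset, (((R.powersetCard n).filter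
        (fun S => η < |(A.card : ℝ) / R.card - ((S ∩ A).card : ℝ) / n|)).card : ℝ) := by
    exact_mod_cast (card_le_card hsub).trans card_biUnion_le
  refine h1.trans ?_
  have h2 : ∀ A ∈ hfin.toFinset, (((R.powersetCard n).filter
        (fun S => η < |(A.card : ℝ) / R.card - ((S ∩ A).card : ℝ) / n|)).card : ℝ)
        ≤ 2 * ((R.card.choose n : ℝ) * Real.exp (-(n * η ^ 2 / 4))) := by
    intro A hA
    rw [hfin.mem_toFinset] at hA
    obtain ⟨A, _, rfl⟩ := hA
    exact card_filter_deviation_le R _ (filter_subset _ _) hn hnR hη hη1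
  refine (sum_le_card_nsmul _ _ _ h2).trans ?_
  rw [nsmul_eq_mul]
  have h3 : (hfin.toFinset.card : ℝ) ≤ (R.card : ℝ) ^ d := by
    rw [← Set.ncard_eq_toFinset_card _ hfin]
    exact_mod_cast h R subset_rfl hR
  gcongr

open Classical in
/-- Two-stage sampling: a random `n`-subset of a random `M`-subset is a random `n`-subset. -/
theorem card_filter_not_isApprox_le_of_two_stage {𝒬 : Set (Set α)} {R : Finset α} {n M : ℕ}
    (hnM : n ≤ M) (hM : M ≤ R.card) {η θ β γ : ℝ}
    (hT : (((R.powersetCard M).filter (fun T => ¬ IsApprox 𝒬 η R T)).card : ℝ)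
      ≤ β * (R.card.choose M : ℝ))
    (hS : ∀ T ∈ R.powersetCard M, (((T.powersetCard n).filter
      (fun S => ¬ IsApprox 𝒬 θ T S)).card : ℝ) ≤ γ * (M.choose n : ℝ)) :
    (((R.powersetCard n).filter (fun S => ¬ IsApprox 𝒬 (η + θ) R S)).card : ℝ)
      ≤ (β + γ) * (R.card.choose n : ℝ) := by
  have h1 := sum_powersetCard_powersetCard R hnM
    (fun S => if ¬ IsApprox 𝒬 (η + θ) R S then (1 : ℝ) else 0)
  have e : ∀ T : Finset α, ∑ S ∈ T.powersetCard n,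
      (if ¬ IsApprox 𝒬 (η + θ) R S then (1 : ℝ) else 0)
      = (((T.powersetCard n).filter (fun S => ¬ IsApprox 𝒬 (η + θ) R S)).card : ℝ) := by
    intro T
    rw [← sum_filter, sum_const, nsmul_eq_mul, mul_one]
  simp only [e] at h1
  -- A bad `T` is charged all its `n`-subsets, a good one only those that fail to represent `T`.
  have h2 : ∀ T ∈ R.powersetCard M,
      (((T.powersetCard n).filter (fun S => ¬ IsApprox 𝒬 (η + θ) R S)).card : ℝ)
      ≤ (if ¬ IsApprox 𝒬 η R T then (M.choose n : ℝ) else 0) + γ * (M.choose n : ℝ) := by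
    intro T hTR
    by_cases hA : IsApprox 𝒬 η R T
    · rw [if_neg (not_not.2 hA), zero_add]
      refine le_trans ?_ (hS T hTR)
      refine Nat.cast_le.2 (card_le_card fun S => ?_)
      rw [mem_filter, mem_filter]
      exact fun h => ⟨h.1, fun h' => h.2 (hA.trans h')⟩
    · rw [if_pos hA]
      have h3 : (((T.powersetCard n).filter (fun S => ¬ IsApprox 𝒬 (η + θ) R S)).card : ℝ)
          ≤ (M.choose n : ℝ) := by
        have := card_filter_le (T.powersetCard n) (fun S => ¬ IsApprox 𝒬 (η + θ) R S)
        rw [card_powersetCard, (mem_powersetCard.1 hTR).2] at this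
        exact_mod_cast this
      have h4 := (Nat.cast_nonneg _).trans (hS T hTR)
      linarith
  have h3 := sum_le_sum h2
  rw [h1, sum_add_distrib, ← sum_filter, sum_const, sum_const, card_powersetCard, nsmul_eq_mul,
    nsmul_eq_mul] at h3
  have hid : (R.card.choose M : ℝ) * (M.choose n : ℝ)
      = (R.card.choose n : ℝ) * ((R.card - n).choose (M - n) : ℝ) := by
    exact_mod_cast Nat.choose_mul hnM
  have hpos : (0 : ℝ) < ((R.card - n).choose (M - n) : ℝ) := by
    exact_mod_cast Nat.choose_pos (by omega)
  refine le_of_mul_le_mul_left ?_ hpos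
  refine h3.trans ?_
  calc _ ≤ β * (R.card.choose M : ℝ) * (M.choose n : ℝ)
        + (R.card.choose M : ℝ) * (γ * (M.choose n : ℝ)) := by gcongr
    _ = (β + γ) * ((R.card.choose M : ℝ) * (M.choose n : ℝ)) := by ring
    _ = _ := by rw [hid]; ring

/-- For a ground set of size at most `n ^ 2` the union bound costs only `2 * d * log n` in the
exponent. -/
theorem two_mul_pow_mul_exp_le {N n d : ℕ} (hN : 0 < N) (hNn : N ≤ n ^ 2) {x δ : ℝ} (hδ : 0 < δ)
    (h : Real.log (2 / δ) + 2 * d * Real.log n ≤ x) :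
    (N : ℝ) ^ d * (2 * Real.exp (-x)) ≤ δ := by
  have hn : (0 : ℝ) < n := by
    have : 0 < n := Nat.pos_of_ne_zero (by rintro rfl; simp at hNn; omega)
    exact_mod_cast this
  have h1 : (N : ℝ) ^ d ≤ Real.exp (2 * d * Real.log n) := by
    have : Real.exp (2 * d * Real.log n) = ((n : ℝ) ^ 2) ^ d := by
      rw [show 2 * (d : ℝ) * Real.log n = ((2 * d : ℕ) : ℝ) * Real.log n by push_cast; ring,
        Real.exp_nat_mul, Real.exp_log hn, pow_mul]
    rw [this]
    exact pow_le_pow_left₀ (by positivity) (by exact_mod_cast hNn) d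
  have h2 : Real.exp (-x) ≤ Real.exp (-(2 * d * Real.log n)) * (δ / 2) := by
    rw [show δ / 2 = Real.exp (-Real.log (2 / δ)) by
      rw [← Real.log_inv, Real.exp_log (by positivity), inv_div], ← Real.exp_add]
    exact Real.exp_le_exp.2 (by linarith)
  calc (N : ℝ) ^ d * (2 * Real.exp (-x))
      ≤ Real.exp (2 * d * Real.log n) * (2 * (Real.exp (-(2 * d * Real.log n)) * (δ / 2))) := by
        gcongr
    _ = (Real.exp (2 * d * Real.log n) * Real.exp (-(2 * d * Real.log n))) * δ := by ring
    _ = δ := by rw [← Real.exp_add, add_neg_cancel, Real.exp_zero, one_mul]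

open Classical in
/-- Uniform convergence for sampling without replacement from a range space of polynomial
growth. The sample is drawn through intermediate samples of sizes `n ^ 2`, `n ^ 4`, and so on. -/
theorem card_filter_not_isApprox_le_mul {𝒬 : Set (Set α)} {R : Finset α} {d : ℕ}
    (h : HasGrowth 𝒬 R d) {n : ℕ} (hn : 8 ≤ n) (hnR : n ≤ R.card) {η δ : ℝ}
    (hη : 0 ≤ η) (hη1 : η ≤ 1) (hδ : 0 < δ) (hδ1 : δ ≤ 1)
    (hcond : Real.log (4 / δ) + 2 * d * Real.log n ≤ n * η ^ 2 / 16) :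
    (((R.powersetCard n).filter (fun S => ¬ IsApprox 𝒬 η R S)).card : ℝ)
      ≤ δ * (R.card.choose n : ℝ) := by
  induction hj : R.card - n using Nat.strong_induction_on generalizing n η δ with
  | _ j ih =>
  have step : ∀ T ⊆ R, n ≤ T.card → T.card ≤ n ^ 2 →
      (((T.powersetCard n).filter (fun S => ¬ IsApprox 𝒬 (η / 2) T S)).card : ℝ)
        ≤ δ / 2 * (T.card.choose n : ℝ) := by
    intro T hTR hnT hTn
    have h1 := card_filter_not_isApprox_le (h.mono hTR) (by omega) (by omega) hnT
      (η := η / 2) (by linarith) (by linarith)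
    have h2 := two_mul_pow_mul_exp_le (N := T.card) (n := n) (d := d) (by omega) hTn
      (x := n * (η / 2) ^ 2 / 4) (δ := δ / 2) (by linarith) (by
        rw [show 2 / (δ / 2) = 4 / δ by field_simp; norm_num,
          show n * (η / 2) ^ 2 / 4 = n * η ^ 2 / 16 by ring]
        exact hcond)
    calc _ ≤ _ := h1
      _ = ((T.card : ℝ) ^ d * (2 * Real.exp (-(n * (η / 2) ^ 2 / 4)))) * (T.card.choose n : ℝ) := by
        ring
      _ ≤ _ := by gcongr
  rcases le_or_gt R.card (n ^ 2) with hle | hlt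
  · refine le_trans ?_ ((step R subset_rfl hnR hle).trans
      (mul_le_mul_of_nonneg_right (by linarith) (by positivity)))
    refine Nat.cast_le.2 (card_le_card fun S => ?_)
    rw [mem_filter, mem_filter]
    exact fun h => ⟨h.1, fun h' => h.2 fun A hA => (h' A hA).trans (by linarith)⟩
  · have hnn : n < n ^ 2 := by nlinarith
    have hlog : Real.log (4 / (δ / 2)) ≤ 2 * Real.log (4 / δ) := by
      have h4 : 4 / (δ / 2) ≤ (4 / δ) ^ 2 := by
        rw [div_pow, div_div_eq_mul_div, div_le_div_iff₀ hδ (by positivity)]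
        nlinarith
      calc _ ≤ Real.log ((4 / δ) ^ 2) := Real.log_le_log (by positivity) h4
        _ = _ := by rw [Real.log_pow]; norm_num
    have h8 : (8 : ℝ) ≤ n := by exact_mod_cast hn
    -- Passing to `n ^ 2`, `η / 2`, `δ / 2` at most doubles the left side of `hcond` and multiplies
    -- its right side by `n / 4 ≥ 2`; this is where `8 ≤ n` enters.
    have hT := ih (R.card - n ^ 2) (by omega) (n := n ^ 2) (by omega) hlt.le (η := η / 2)
      (δ := δ / 2) (by linarith) (by linarith) (by linarith) (by linarith) (by
        push_cast
        rw [Real.log_pow]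
        push_cast
        have hp : (0 : ℝ) ≤ n * η ^ 2 / 16 := by positivity
        have : (n : ℝ) ^ 2 * (η / 2) ^ 2 / 16 = n / 4 * (n * η ^ 2 / 16) := by ring
        rw [this]
        nlinarith) rfl
    have := card_filter_not_isApprox_le_of_two_stage (n := n) (𝒬 := 𝒬) hnn.le hlt.le hT
      (θ := η / 2) (γ := δ / 2) (by
        intro T hT
        rw [mem_powersetCard] at hT
        have := step T hT.1 (by omega) (by omega)
        rwa [hT.2] at this)
    rwa [add_halves, add_halves] at this

end RangeSpace

/-! ### From relative sizes of sublevel sets to averages of powers. -/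

section Average

variable {α : Type*}

/-- The average of `φ` over the finite set `P`. -/
def avg (P : Finset α) (φ : α → ℝ) : ℝ := (∑ x ∈ P, φ x) / P.card

theorem avg_mono {P : Finset α} {φ ψ : α → ℝ} (h : ∀ x ∈ P, φ x ≤ ψ x) : avg P φ ≤ avg P ψ :=
  div_le_div_of_nonneg_right (sum_le_sum h) (Nat.cast_nonneg _)

theorem avg_const {P : Finset α} (hP : P.Nonempty) (a : ℝ) : avg P (fun _ => a) = a := by
  have : (P.card : ℝ) ≠ 0 := by exact_mod_cast hP.card_pos.ne'
  rw [avg, sum_const, nsmul_eq_mul, mul_div_cancel_left₀ _ this]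

theorem avg_const_mul (P : Finset α) (a : ℝ) (φ : α → ℝ) :
    avg P (fun x => a * φ x) = a * avg P φ := by
  rw [avg, avg, ← mul_sum, mul_div_assoc]

theorem avg_add (P : Finset α) (φ ψ : α → ℝ) :
    avg P (fun x => φ x + ψ x) = avg P φ + avg P ψ := by
  rw [avg, avg, avg, sum_add_distrib, add_div]

theorem le_avg {P : Finset α} (hP : P.Nonempty) {φ : α → ℝ} {a : ℝ} (h : ∀ x ∈ P, a ≤ φ x) :
    a ≤ avg P φ :=
  (avg_const hP a).symm.le.trans (avg_mono h)

theorem avg_le {P : Finset α} (hP : P.Nonempty) {φ : α → ℝ} {a : ℝ} (h : ∀ x ∈ P, φ x ≤ a) :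
    avg P φ ≤ a :=
  (avg_mono h).trans (avg_const hP a).le

theorem monotone_ite_le (a : ℝ) : Monotone (fun τ : ℝ => if a ≤ τ then (1 : ℝ) else 0) := by
  intro s t hst
  dsimp only
  split_ifs with h1 h2
  · exact le_rfl
  · exact absurd (h1.trans hst) h2
  · exact zero_le_one
  · exact le_rfl

theorem integral_ite_le {L U a : ℝ} (h1 : L ≤ a) (h2 : a ≤ U) :
    ∫ τ in L..U, (if a ≤ τ then (1 : ℝ) else 0) = U - a := by
  have hi : ∀ s t : ℝ, IntervalIntegrable (fun τ : ℝ => if a ≤ τ then (1 : ℝ) else 0)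
      MeasureTheory.volume s t := fun s t => (monotone_ite_le a).intervalIntegrable
  rw [← intervalIntegral.integral_add_adjacent_intervals (hi L a) (hi a U)]
  have e1 : ∫ τ in L..a, (if a ≤ τ then (1 : ℝ) else 0) = ∫ _ in L..a, (0 : ℝ) := by
    -- The integrands differ at the endpoint `a`, hence the passage to the open interval.
    rw [intervalIntegral.integral_of_le h1, intervalIntegral.integral_of_le h1,
      MeasureTheory.integral_Ioc_eq_integral_Ioo, MeasureTheory.integral_Ioc_eq_integral_Ioo]
    exact MeasureTheory.setIntegral_congr_fun measurableSet_Ioo fun τ hτ => if_neg hτ.2.not_ge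
  have e2 : ∫ τ in a..U, (if a ≤ τ then (1 : ℝ) else 0) = ∫ _ in a..U, (1 : ℝ) := by
    refine intervalIntegral.integral_congr fun τ hτ => ?_
    rw [Set.uIcc_of_le h2] at hτ
    exact if_pos hτ.1
  rw [e1, e2]
  simp

open Classical in
-- Layer-cake formula: each `x` contributes the length `U - h x` of the thresholds above `h x`.
theorem integral_frac_eq {P : Finset α} (hP : P.Nonempty) {h : α → ℝ} {L U : ℝ}
    (hL : ∀ x ∈ P, L ≤ h x) (hU : ∀ x ∈ P, h x ≤ U) :
    IntervalIntegrable (fun τ : ℝ => ((P.filter (h · ≤ τ)).card : ℝ) / P.card)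
      MeasureTheory.volume L U ∧
    ∫ τ in L..U, ((P.filter (h · ≤ τ)).card : ℝ) / P.card = U - avg P h := by
  have hc : (P.card : ℝ) ≠ 0 := by exact_mod_cast hP.card_pos.ne'
  have e : ∀ τ : ℝ, ((P.filter (h · ≤ τ)).card : ℝ) / P.card
      = (∑ x ∈ P, if h x ≤ τ then (1 : ℝ) else 0) / P.card := by
    intro τ
    rw [← sum_filter, sum_const, nsmul_eq_mul, mul_one]
  simp only [e]
  have hi : ∀ x ∈ P, IntervalIntegrable (fun τ : ℝ => if h x ≤ τ then (1 : ℝ) else 0)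
      MeasureTheory.volume L U := fun x _ => (monotone_ite_le (h x)).intervalIntegrable
  constructor
  · refine Monotone.intervalIntegrable fun s t hst => ?_
    exact div_le_div_of_nonneg_right (sum_le_sum fun x _ => monotone_ite_le (h x) hst)
      (Nat.cast_nonneg _)
  · rw [intervalIntegral.integral_div, intervalIntegral.integral_finsetSum hi,
      sum_congr rfl fun x hx => integral_ite_le (hL x hx) (hU x hx), sum_sub_distrib, sum_const,
      nsmul_eq_mul, avg]
    field_simp

open Classical in
/-- Averages of a bounded function are close if the relative sizes of its sublevel sets are. -/
theorem abs_avg_sub_avg_le {R S : Finset α} (hR : R.Nonempty) (hS : S.Nonempty) {h : α → ℝ}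
    {L U η : ℝ} (hLU : L ≤ U) (hRh : ∀ x ∈ R, L ≤ h x ∧ h x ≤ U)
    (hSh : ∀ x ∈ S, L ≤ h x ∧ h x ≤ U)
    (happ : ∀ τ : ℝ, L ≤ τ → |((R.filter (h · ≤ τ)).card : ℝ) / R.card
      - ((S.filter (h · ≤ τ)).card : ℝ) / S.card| ≤ η) :
    |avg R h - avg S h| ≤ η * (U - L) := by
  obtain ⟨i1, e1⟩ := integral_frac_eq hR (fun x hx => (hRh x hx).1) (fun x hx => (hRh x hx).2)
  obtain ⟨i2, e2⟩ := integral_frac_eq hS (fun x hx => (hSh x hx).1) (fun x hx => (hSh x hx).2)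
  have h1 := intervalIntegral.integral_sub i1 i2
  rw [e1, e2] at h1
  have h2 : |avg R h - avg S h| = |U - avg R h - (U - avg S h)| := by
    rw [abs_sub_comm]
    congr 1
    ring
  rw [h2, ← h1, ← Real.norm_eq_abs]
  refine (intervalIntegral.norm_integral_le_of_norm_le_const (C := η) fun τ hτ => ?_).trans ?_
  · rw [Set.uIoc_of_le hLU] at hτ
    exact happ τ hτ.1.le
  · rw [abs_of_nonneg (by linarith)]

open Classical in
-- Sublevel sets of `g ^ z` at `τ` are those of `g` at `τ ^ z⁻¹`, so no new ranges arise.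
theorem abs_avg_rpow_sub_avg_rpow_le {R S : Finset α} (hR : R.Nonempty) (hS : S.Nonempty)
    (hSR : S ⊆ R) {g : α → ℝ} {z L U η : ℝ} (hz : 0 < z) (hg : ∀ x ∈ R, 0 ≤ g x) (hL : 0 ≤ L)
    (hLU : L ≤ U) (hgLU : ∀ x ∈ R, L ≤ g x ^ z ∧ g x ^ z ≤ U)
    (happ : ∀ τ : ℝ, 0 ≤ τ → |((R.filter (g · ≤ τ)).card : ℝ) / R.card
      - ((S.filter (g · ≤ τ)).card : ℝ) / S.card| ≤ η) :
    |avg R (fun x => g x ^ z) - avg S (fun x => g x ^ z)| ≤ η * (U - L) := by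
  refine abs_avg_sub_avg_le hR hS hLU hgLU (fun x hx => hgLU x (hSR hx)) fun τ hτ => ?_
  have h0 : 0 ≤ τ := hL.trans hτ
  have e : ∀ P ⊆ R, P.filter (fun x => g x ^ z ≤ τ) = P.filter (fun x => g x ≤ τ ^ z⁻¹) := by
    intro P hP
    refine filter_congr fun x hx => ?_
    exact (Real.le_rpow_inv_iff_of_pos (hg x (hP hx)) h0 hz).symm
  rw [e R subset_rfl, e S hSR]
  exact happ _ (Real.rpow_nonneg h0 _)

open Classical in
/-- The comparison of the averages of `d ^ z` for `z ≤ 1`. -/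
theorem abs_avg_rpow_sub_le_of_le_one {R S : Finset α} (hR : R.Nonempty) (hS : S.Nonempty)
    (hSR : S ⊆ R) {d g : α → ℝ} {z r ε η : ℝ} (hz : 0 < z) (hz1 : z ≤ 1) (hr : 0 < r)
    (hε : 0 < ε) (hε1 : ε < 1) (hη : η ≤ ε / 12) (hd : ∀ x ∈ R, 0 ≤ d x)
    (hdd : ∀ x ∈ R, ∀ y ∈ R, d x ≤ d y + 4 * r) (hdg : ∀ x ∈ R, d x ≤ g x)
    (hgd : ∀ x ∈ R, g x ≤ (1 + ε) * d x)
    (happ : ∀ τ : ℝ, 0 ≤ τ → |((R.filter (g · ≤ τ)).card : ℝ) / R.card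
      - ((S.filter (g · ≤ τ)).card : ℝ) / S.card| ≤ η) :
    |avg R (fun x => d x ^ z) - avg S (fun x => d x ^ z)|
      ≤ ε * (avg R (fun x => d x ^ z) + r ^ z) := by
  obtain ⟨x₀, hx₀, hmin⟩ := R.exists_min_image d hR
  set l := d x₀ with hl
  have hl0 : 0 ≤ l := hd x₀ hx₀
  have hup : ∀ x ∈ R, d x ≤ l + 4 * r := fun x hx => hdd x hx x₀ hx₀
  have hrz : 0 < r ^ z := Real.rpow_pos_of_pos hr z
  have hpow : (1 + ε) ^ z ≤ 1 + ε := by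
    calc (1 + ε) ^ z ≤ (1 + ε) ^ (1 : ℝ) := Real.rpow_le_rpow_of_exponent_le (by linarith) hz1
      _ = _ := Real.rpow_one _
  have hlow : ∀ x ∈ R, l ^ z ≤ d x ^ z := fun x hx => Real.rpow_le_rpow hl0 (hmin x hx) hz.le
  -- If `ε * l ≤ 4 * r`, the values `g x ^ z` lie in an interval of length `12 * r ^ z`. Otherwise
  -- `d` varies on `R` by a factor at most `1 + ε`, and any two averages agree well enough without
  -- sampling.
  rcases le_or_gt (ε * l) (4 * r) with hcase | hcase
  · have hgU : ∀ x ∈ R, g x ^ z ≤ l ^ z + 12 * r ^ z := by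
      intro x hx
      have h1 : g x ≤ l + 12 * r := by nlinarith [hgd x hx, hup x hx]
      calc g x ^ z ≤ (l + 12 * r) ^ z :=
            Real.rpow_le_rpow ((hd x hx).trans (hdg x hx)) h1 hz.le
        _ ≤ l ^ z + (12 * r) ^ z := Real.rpow_add_le_add_rpow hl0 (by linarith) hz.le hz1
        _ = l ^ z + 12 ^ z * r ^ z := by rw [Real.mul_rpow (by norm_num) hr.le]
        _ ≤ l ^ z + 12 ^ (1 : ℝ) * r ^ z := by gcongr; norm_num
        _ = _ := by rw [Real.rpow_one]
    have hgL : ∀ x ∈ R, d x ^ z ≤ g x ^ z := fun x hx => Real.rpow_le_rpow (hd x hx) (hdg x hx) hz.le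
    have hgd' : ∀ x ∈ R, g x ^ z ≤ (1 + ε) * d x ^ z := by
      intro x hx
      calc g x ^ z ≤ ((1 + ε) * d x) ^ z :=
            Real.rpow_le_rpow ((hd x hx).trans (hdg x hx)) (hgd x hx) hz.le
        _ = (1 + ε) ^ z * d x ^ z := Real.mul_rpow (by linarith) (hd x hx)
        _ ≤ _ := mul_le_mul_of_nonneg_right hpow (Real.rpow_nonneg (hd x hx) z)
    have hstat := abs_avg_rpow_sub_avg_rpow_le hR hS hSR hz
      (fun x hx => (hd x hx).trans (hdg x hx)) (Real.rpow_nonneg hl0 z)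
      (by linarith : l ^ z ≤ l ^ z + 12 * r ^ z)
      (fun x hx => ⟨(hlow x hx).trans (hgL x hx), hgU x hx⟩) happ
    have hs : η * (l ^ z + 12 * r ^ z - l ^ z) ≤ ε * r ^ z := by nlinarith
    have h1 := abs_le.1 (hstat.trans hs)
    have h2 := avg_mono hgL
    have h3 := avg_mono hgd'
    have h4 := avg_mono fun x hx => hgL x (hSR hx)
    have h5 := avg_mono fun x hx => hgd' x (hSR hx)
    rw [avg_const_mul] at h3 h5
    have h6 : 0 ≤ avg R (fun x => d x ^ z) := le_avg hR fun x hx => Real.rpow_nonneg (hd x hx) z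
    rw [abs_le]
    constructor
    · linarith
    · have h7 : (1 + ε) * avg S (fun x => d x ^ z) ≥ avg R (fun x => d x ^ z) - ε * r ^ z := by
        linarith
      -- Since `(1 + ε) * (1 - ε) ≤ 1`, the one-sided distortion costs only `ε` here too, so no
      -- smaller distortion is needed.
      have h8 : (1 + ε) * ((1 - ε) * avg R (fun x => d x ^ z) - ε * r ^ z)
          ≤ (1 + ε) * avg S (fun x => d x ^ z) := by
        refine le_trans ?_ h7
        have : 0 ≤ ε * r ^ z := by positivity
        nlinarith [mul_nonneg (sq_nonneg ε) h6]
      have h9 := le_of_mul_le_mul_left h8 (by linarith)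
      linarith
  · have hU : ∀ x ∈ R, d x ^ z ≤ (1 + ε) * l ^ z := by
      intro x hx
      calc d x ^ z ≤ ((1 + ε) * l) ^ z :=
            Real.rpow_le_rpow (hd x hx) (by linarith [hup x hx]) hz.le
        _ = (1 + ε) ^ z * l ^ z := Real.mul_rpow (by linarith) hl0
        _ ≤ _ := mul_le_mul_of_nonneg_right hpow (Real.rpow_nonneg hl0 z)
    have h1 := le_avg hR hlow
    have h2 := avg_le hR hU
    have h3 := le_avg hS fun x hx => hlow x (hSR hx)
    have h4 := avg_le hS fun x hx => hU x (hSR hx)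
    rw [abs_le]
    constructor <;> nlinarith

/-- Bound `1 + u` by `exp u`, take the power, and use `exp v ≤ 1 + 2 * v` for `0 ≤ v ≤ 1`. -/
theorem one_add_div_rpow_le {z ε : ℝ} (hz : 0 < z) (hε : 0 < ε) (hε1 : ε < 1) :
    (1 + ε / (8 * z * 8 ^ z)) ^ z ≤ 1 + ε / (4 * 8 ^ z) := by
  have h8 : (1 : ℝ) ≤ 8 ^ z := Real.one_le_rpow (by norm_num) hz.le
  have hv0 : 0 ≤ ε / (8 * 8 ^ z) := by positivity
  have hv1 : ε / (8 * 8 ^ z) ≤ 1 := by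
    rw [div_le_one (by positivity)]
    linarith
  calc (1 + ε / (8 * z * 8 ^ z)) ^ z ≤ Real.exp (ε / (8 * z * 8 ^ z)) ^ z := by
        refine Real.rpow_le_rpow (by positivity) ?_ hz.le
        rw [add_comm]
        exact Real.add_one_le_exp _
    _ = Real.exp (ε / (8 * 8 ^ z)) := by
        rw [← Real.exp_mul]
        congr 1
        field_simp
    _ ≤ 1 + ε / (8 * 8 ^ z) + (ε / (8 * 8 ^ z)) ^ 2 := by
        have := abs_le.1 (Real.abs_exp_sub_one_sub_id_le (x := ε / (8 * 8 ^ z))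
          (by rw [abs_of_nonneg hv0]; exact hv1))
        linarith
    _ ≤ 1 + 2 * (ε / (8 * 8 ^ z)) := by nlinarith
    _ = _ := by field_simp; ring

open Classical in
/-- The comparison of the averages of `d ^ z` for functions approximated well enough. -/
theorem abs_avg_rpow_sub_le {R S : Finset α} (hR : R.Nonempty) (hS : S.Nonempty)
    (hSR : S ⊆ R) {d g : α → ℝ} {z r ε η : ℝ} (hz : 0 < z) (hr : 0 < r)
    (hε : 0 < ε) (hε1 : ε < 1) (hη : η ≤ ε / (8 * 8 ^ z)) (hd : ∀ x ∈ R, 0 ≤ d x)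
    (hdd : ∀ x ∈ R, ∀ y ∈ R, d x ≤ d y + 4 * r) (hdg : ∀ x ∈ R, d x ≤ g x)
    (hgd : ∀ x ∈ R, g x ≤ (1 + ε / (8 * z * 8 ^ z)) * d x)
    (happ : ∀ τ : ℝ, 0 ≤ τ → |((R.filter (g · ≤ τ)).card : ℝ) / R.card
      - ((S.filter (g · ≤ τ)).card : ℝ) / S.card| ≤ η) :
    |avg R (fun x => d x ^ z) - avg S (fun x => d x ^ z)|
      ≤ ε * (avg R (fun x => d x ^ z) + r ^ z) := by
  obtain ⟨x₀, hx₀, hmin⟩ := R.exists_min_image d hR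
  set l := d x₀ with hl
  have hl0 : 0 ≤ l := hd x₀ hx₀
  have h8 : (1 : ℝ) ≤ 8 ^ z := Real.one_le_rpow (by norm_num) hz.le
  -- All `d x ^ z` are at most `8 ^ z * T`. Distortion and sampling then cost at most `ε * T / 4`
  -- each.
  set T := avg R (fun x => d x ^ z) + r ^ z with hT
  have hlT : l ^ z + r ^ z ≤ T := by
    have := le_avg hR fun x hx => Real.rpow_le_rpow hl0 (hmin x hx) hz.le
    linarith
  have hT0 : 0 ≤ T := le_trans (by positivity) hlT
  have hdM : ∀ x ∈ R, d x ^ z ≤ 8 ^ z * T := by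
    intro x hx
    have h1 : d x ≤ 8 * max l r := by
      have := hdd x hx x₀ hx₀
      have h2 := le_max_left l r
      have h3 := le_max_right l r
      linarith
    have h2 : max l r ^ z ≤ l ^ z + r ^ z := by
      rcases max_choice l r with h | h <;> rw [h]
      · linarith [Real.rpow_nonneg hr.le z]
      · linarith [Real.rpow_nonneg hl0 z]
    calc d x ^ z ≤ (8 * max l r) ^ z := Real.rpow_le_rpow (hd x hx) h1 hz.le
      _ = 8 ^ z * max l r ^ z := Real.mul_rpow (by norm_num) (le_max_of_le_left hl0)
      _ ≤ 8 ^ z * T := by gcongr; exact h2.trans hlT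
  have hg0 : ∀ x ∈ R, 0 ≤ g x := fun x hx => (hd x hx).trans (hdg x hx)
  have hgL : ∀ x ∈ R, d x ^ z ≤ g x ^ z := fun x hx =>
    Real.rpow_le_rpow (hd x hx) (hdg x hx) hz.le
  have hgd' : ∀ x ∈ R, g x ^ z ≤ d x ^ z + ε * T / 4 := by
    intro x hx
    calc g x ^ z ≤ ((1 + ε / (8 * z * 8 ^ z)) * d x) ^ z :=
          Real.rpow_le_rpow (hg0 x hx) (hgd x hx) hz.le
      _ = (1 + ε / (8 * z * 8 ^ z)) ^ z * d x ^ z := Real.mul_rpow (by positivity) (hd x hx)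
      _ ≤ (1 + ε / (4 * 8 ^ z)) * d x ^ z :=
          mul_le_mul_of_nonneg_right (one_add_div_rpow_le hz hε hε1) (Real.rpow_nonneg (hd x hx) z)
      _ = d x ^ z + ε / (4 * 8 ^ z) * d x ^ z := by ring
      _ ≤ d x ^ z + ε / (4 * 8 ^ z) * (8 ^ z * T) := by gcongr; exact hdM x hx
      _ = _ := by field_simp
  have hgU : ∀ x ∈ R, g x ^ z ≤ 2 * 8 ^ z * T := by
    intro x hx
    have h1 := hgd' x hx
    have h2 := hdM x hx
    have h3 : ε * T / 4 ≤ 8 ^ z * T := by nlinarith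
    linarith
  have hstat := abs_avg_rpow_sub_avg_rpow_le hR hS hSR hz hg0 le_rfl
    (by positivity : (0 : ℝ) ≤ 2 * 8 ^ z * T)
    (fun x hx => ⟨Real.rpow_nonneg (hg0 x hx) z, hgU x hx⟩) happ
  have hs : η * (2 * 8 ^ z * T - 0) ≤ ε * T / 4 := by
    calc η * (2 * 8 ^ z * T - 0) ≤ ε / (8 * 8 ^ z) * (2 * 8 ^ z * T - 0) := by
          refine mul_le_mul_of_nonneg_right hη ?_
          rw [sub_zero]
          positivity
      _ = _ := by field_simp; ring
  have h1 := abs_le.1 (hstat.trans hs)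
  have h2 := avg_mono hgL
  have h3 := avg_mono hgd'
  have h4 := avg_mono fun x hx => hgL x (hSR hx)
  have h5 := avg_mono fun x hx => hgd' x (hSR hx)
  rw [avg_add, avg_const hR] at h3
  rw [avg_add, avg_const hS] at h5
  have h6 : 0 ≤ ε * T := by positivity
  rw [abs_le]
  constructor <;> linarith

end Average

/-! ### Counting the traces of unions of `k` balls. -/

section Ranges

variable {X : Type*}

/-- The ranges `{x ∈ R : min_{y ∈ C} f_x(y) ≤ ρ}` for nonempty sets `C` of at most `k` centers. -/
def centerRanges {R : Finset X} (f : {x // x ∈ R} → X → ℝ≥0) (k : ℕ) : Set (Set X) :=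
  {A | ∃ C : Finset X, C.Nonempty ∧ C.card ≤ k ∧ ∃ ρ : ℝ≥0,
    A = {x | ∃ hx : x ∈ R, ∃ y ∈ C, f ⟨x, hx⟩ y ≤ ρ}}

theorem finite_traces (F : Set (X → ℝ≥0)) (H : Finset (X → ℝ≥0)) : (traces F H).Finite :=
  H.finite_toSet.powerset.subset (by
    rintro _ ⟨c, r, rfl⟩
    exact Set.inter_subset_right)

theorem ncard_traces_le (F : Set (X → ℝ≥0)) (H : Finset (X → ℝ≥0)) :
    (traces F H).ncard ≤ 2 ^ H.card := by
  rw [← Set.ncard_coe_finset H, ← Set.ncard_powerset _ H.finite_toSet]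
  refine Set.ncard_le_ncard ?_ H.finite_toSet.powerset
  rintro _ ⟨c, r, rfl⟩
  exact Set.inter_subset_right

/-- The infimum is attained because `2 ^ |H| ≤ |H| ^ |H|` makes its set of exponents nonempty; the
`+ 1` in the witness covers empty `F`. -/
theorem sdim_spec {F : Set (X → ℝ≥0)} (hF : F.Finite) :
    1 ≤ sdim F ∧ ∀ H : Finset (X → ℝ≥0), (H : Set (X → ℝ≥0)) ⊆ F → 2 ≤ H.card →
      (traces F H).ncard ≤ H.card ^ sdim F := by
  refine Nat.sInf_mem (s := {t : ℕ | 1 ≤ t ∧ ∀ H : Finset (X → ℝ≥0),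
    (H : Set (X → ℝ≥0)) ⊆ F → 2 ≤ H.card → (traces F H).ncard ≤ H.card ^ t})
    ⟨F.ncard + 1, by omega, fun H hH h2 => ?_⟩
  have h1 : H.card ≤ F.ncard := by
    rw [← Set.ncard_coe_finset H]
    exact Set.ncard_le_ncard hH hF
  calc (traces F H).ncard ≤ 2 ^ H.card := ncard_traces_le F H
    _ ≤ H.card ^ H.card := Nat.pow_le_pow_left h2 _
    _ ≤ H.card ^ (F.ncard + 1) := Nat.pow_le_pow_right (by omega) (by omega)

/-- Repetitions pad the centers to a `k`-tuple, so that tuples of ball traces can be counted. -/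
theorem exists_fin_range_eq {C : Finset X} (hC : C.Nonempty) {k : ℕ} (hk : C.card ≤ k) :
    ∃ e : Fin k → X, ∀ y, y ∈ C ↔ ∃ i, e i = y := by
  have : Nonempty {y // y ∈ C} := hC.to_subtype
  obtain ⟨φ⟩ : Nonempty ({y // y ∈ C} ↪ Fin k) :=
    Function.Embedding.nonempty_of_card_le (by simpa using hk)
  refine ⟨fun i => (Function.invFun φ i : {y // y ∈ C}), fun y => ⟨fun hy => ⟨φ ⟨y, hy⟩, ?_⟩, ?_⟩⟩
  · simp only [Function.leftInverse_invFun φ.injective _]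
  · rintro ⟨i, rfl⟩
    exact (Function.invFun φ i).2

open Classical in
-- Each trace is a union of `k` ball traces, with at most `|H| ^ sdim` choices for each. Injectivity
-- makes `H` and its set of functions equally large.
theorem hasGrowth_centerRanges {R : Finset X} {f : {x // x ∈ R} → X → ℝ≥0}
    (hf : Function.Injective f) (k : ℕ) :
    HasGrowth (centerRanges f k) R (sdim (Set.range f) * k) := by
  intro H hH h2
  have hspec := (sdim_spec (Set.finite_range f)).2
  set t := sdim (Set.range f)
  set H' : Finset (X → ℝ≥0) := H.attach.image fun x => f ⟨x.1, hH x.2⟩ with hH'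
  have hcard : H'.card = H.card := by
    rw [hH', card_image_of_injective, card_attach]
    intro x y hxy
    exact Subtype.ext (Subtype.mk.inj (hf hxy))
  have htr : (traces (Set.range f) H').ncard ≤ H.card ^ t := by
    rw [← hcard]
    refine hspec H' ?_ (by omega)
    intro g hg
    obtain ⟨x, _, rfl⟩ := mem_image.1 (mem_coe.1 hg)
    exact Set.mem_range_self _
  set Φ : Set (X → ℝ≥0) → Finset X := fun G => H.filter fun x => ∃ hx : x ∈ R, f ⟨x, hx⟩ ∈ G
  have hfin : (Φ '' traces (Set.range f) H').Finite := (finite_traces _ _).image Φ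
  have hΦ : hfin.toFinset.card ≤ H.card ^ t := by
    rw [← Set.ncard_eq_toFinset_card _ hfin]
    exact (Set.ncard_image_le (finite_traces _ _)).trans htr
  have hsub : (fun A : Set X => H.filter (· ∈ A)) '' centerRanges f k ⊆
      ((Fintype.piFinset fun _ : Fin k => hfin.toFinset).image fun e => univ.biUnion e :
        Finset (Finset X)) := by
    rintro _ ⟨_, ⟨C, hC, hCk, ρ, rfl⟩, rfl⟩
    obtain ⟨e, he⟩ := exists_fin_range_eq hC hCk
    rw [mem_coe, mem_image]
    refine ⟨fun i => Φ (fball (Set.range f) (e i) ρ ∩ (H' : Set (X → ℝ≥0))), ?_, ?_⟩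
    · rw [Fintype.mem_piFinset]
      intro i
      rw [hfin.mem_toFinset]
      exact ⟨_, ⟨e i, ρ, rfl⟩, rfl⟩
    · ext x
      simp only [Φ, mem_biUnion, mem_univ, true_and, mem_filter, Set.mem_ofPred_eq, fball,
        Set.mem_inter_iff, mem_coe]
      constructor
      · rintro ⟨i, hx, hxR, ⟨_, hle⟩, _⟩
        exact ⟨hx, hxR, e i, (he _).2 ⟨i, rfl⟩, hle⟩
      · rintro ⟨hx, hxR, y, hy, hle⟩
        obtain ⟨i, rfl⟩ := (he y).1 hy
        exact ⟨i, hx, hxR, ⟨Set.mem_range_self _, hle⟩,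
          mem_image.2 ⟨⟨x, hx⟩, mem_attach _ _, rfl⟩⟩
  calc _ ≤ ((Fintype.piFinset fun _ : Fin k => hfin.toFinset).image fun e =>
          univ.biUnion e).card := by
        rw [← Set.ncard_coe_finset]
        exact Set.ncard_le_ncard hsub (Finset.finite_toSet _)
    _ ≤ (Fintype.piFinset fun _ : Fin k => hfin.toFinset).card := card_image_le
    _ = hfin.toFinset.card ^ k := by simp
    _ ≤ (H.card ^ t) ^ k := Nat.pow_le_pow_left hΦ k
    _ = _ := (pow_mul _ _ _).symm

end Ranges

/-! ### The numerical condition on the sample size. -/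

theorem sample_size_sufficient {b ε δ d : ℝ} {m : ℝ} (hb : 1 ≤ b) (hε : 0 < ε) (hε1 : ε < 1)
    (hδ : 0 < δ) (hδ1 : δ < 1) (hd : 1 ≤ d)
    (hm : 32 * b * (Real.log (8 * b) + 1) * (1 / ε) ^ 2 * Real.log (2 * d / ε) * d
      * Real.log (2 / δ) ≤ m) :
    8 ≤ m ∧ b * (1 / ε) ^ 2 * (Real.log (4 / δ) + 2 * d * Real.log m) ≤ m := by
  have hlog2 : (1 / 2 : ℝ) ≤ Real.log 2 := by linarith [Real.log_two_gt_d9]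
  have hL : 1 / 2 ≤ Real.log (2 * d / ε) := hlog2.trans <| Real.log_le_log (by norm_num) <| by
    rw [le_div_iff₀ hε]; nlinarith
  have hl : 1 / 2 ≤ Real.log (2 / δ) := hlog2.trans <| Real.log_le_log (by norm_num) <| by
    rw [le_div_iff₀ hδ]; linarith
  set L := Real.log (2 * d / ε) with hLdef
  set l := Real.log (2 / δ) with hldef
  have hB : 0 ≤ Real.log (8 * b) := Real.log_nonneg (by linarith)
  set β := Real.log (8 * b) with hβ
  have he : 1 ≤ (1 / ε) ^ 2 := one_le_pow₀ (by rw [le_div_iff₀ hε]; linarith)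
  set E := (1 / ε) ^ 2 with hE
  have hbE : 1 ≤ b * E := by nlinarith
  have hbEd : b * E ≤ b * E * d := by nlinarith
  have m1 : 8 * (b * E * d) * l ≤ m / 2 := by
    have h1 : b * E * d * l * (1 / 2) ≤ b * E * d * l * L := by gcongr
    have h2 : 0 ≤ β * (b * E * d * l * L) := by positivity
    nlinarith
  have m2 : 8 * (b * E * d) * ((β + 1) * L) ≤ m / 2 := by
    have h1 : b * E * d * ((β + 1) * L) * (1 / 2) ≤ b * E * d * ((β + 1) * L) * l := by gcongr
    nlinarith
  have hm8 : 8 ≤ m := by nlinarith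
  refine ⟨hm8, ?_⟩
  have h4 : Real.log (4 / δ) ≤ 2 * l := by
    have h4 : 4 / δ ≤ (2 / δ) ^ 2 := by
      rw [div_pow, div_le_div_iff₀ hδ (by positivity)]
      nlinarith
    calc _ ≤ Real.log ((2 / δ) ^ 2) := Real.log_le_log (by positivity) h4
      _ = _ := by rw [Real.log_pow, hldef]; norm_num
  set a := 4 * (b * E * d) with ha
  have ha0 : 0 < a := by positivity
  -- Scaling by `2 * a` makes `a * log m` cost `m / 2` plus a term free of `m`, which `m2` bounds by
  -- the other half.
  have hlogm : Real.log m ≤ m / (2 * a) + Real.log (2 * a) := by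
    have h1 : Real.log m = Real.log (m / (2 * a)) + Real.log (2 * a) := by
      rw [Real.log_div (by linarith) (by positivity)]
      ring
    have h2 := Real.log_le_sub_one_of_pos (x := m / (2 * a)) (by positivity)
    linarith
  have hlog2a : Real.log (2 * a) ≤ 2 * ((β + 1) * L) := by
    have h1 : 2 * a ≤ 8 * b * (2 * d / ε) ^ 2 := by
      have : 8 * b * (2 * d / ε) ^ 2 = 8 * (b * E) * (4 * d ^ 2) := by
        rw [hE]; field_simp; ring
      rw [this]
      have : d ≤ 4 * d ^ 2 := by nlinarith
      calc 2 * a = 8 * (b * E) * d := by rw [ha]; ring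
        _ ≤ _ := by gcongr
    calc Real.log (2 * a) ≤ Real.log (8 * b * (2 * d / ε) ^ 2) :=
          Real.log_le_log (by positivity) h1
      _ = β + 2 * L := by
          rw [Real.log_mul (by positivity) (by positivity), Real.log_pow]
          norm_num [hβ, hLdef]
      _ ≤ _ := by nlinarith
  have h5 : a * Real.log m ≤ m := by
    have h6 : a * Real.log m ≤ a * (m / (2 * a) + 2 * ((β + 1) * L)) :=
      mul_le_mul_of_nonneg_left (by linarith) ha0.le
    have h7 : a * (m / (2 * a) + 2 * ((β + 1) * L)) = m / 2 + 8 * (b * E * d) * ((β + 1) * L) := by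
      rw [ha]; field_simp
      ring
    linarith
  calc b * E * (Real.log (4 / δ) + 2 * d * Real.log m)
      = b * E * Real.log (4 / δ) + a * Real.log m / 2 := by rw [ha]; ring
    _ ≤ b * E * (2 * l) + m / 2 := by gcongr
    _ ≤ b * E * d * (2 * l) + m / 2 := by gcongr
    _ ≤ m := by
      have : 0 ≤ b * E * d * l := by positivity
      linarith

/-! ### From represented ranges to coresets. -/

section Coreset

variable {X : Type*} [MetricSpace X]

/-- The distortion parameter `A_z`. -/
def distortion (z : ℝ) : ℝ := if z ≤ 1 then 1 else 8 * z * 8 ^ z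

theorem one_le_distortion (z : ℝ) : 1 ≤ distortion z := by
  rw [distortion]
  split_ifs with h
  · exact le_rfl
  · have h8 : (1 : ℝ) ≤ 8 ^ z := Real.one_le_rpow (by norm_num) (by linarith)
    nlinarith

/-- The upper bound forces `f x` to vanish at `x`; by the lower bound, `f y` can vanish there only
if `y = x`. -/
theorem injective_of_dist_le {R : Finset X} {f : {x // x ∈ R} → X → ℝ≥0} {a : ℝ}
    (hf : ∀ (x : {x // x ∈ R}) (y : X), dist (x : X) y ≤ f x y ∧ (f x y : ℝ) ≤ a * dist (x : X) y) :
    Function.Injective f := by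
  intro x y hxy
  have h1 := (hf x x).2
  have h2 := (hf y x).1
  rw [dist_self, mul_zero, hxy] at h1
  exact Subtype.ext (dist_le_zero.1 (h2.trans h1)).symm

theorem cost_const (z a : ℝ) (P C : Finset X) :
    cost z P (fun _ => a) C = a * P.card * avg P (fun x => Metric.infDist x C ^ z) := by
  rcases P.eq_empty_or_nonempty with rfl | hP
  · simp [cost]
  · have : (P.card : ℝ) ≠ 0 := by exact_mod_cast hP.card_pos.ne'
    rw [cost, avg, ← mul_sum]
    field_simp

open Classical in
/-- A sample that represents all center ranges is a coreset. -/
theorem isCoreset_of_isApprox {c : X} {r z ε η : ℝ} {k : ℕ} {R S : Finset X}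
    (hz : 0 < z) (hr : 0 < r) (hRing : (R : Set X) ⊆ ring c r (2 * r)) (hε : 0 < ε) (hε1 : ε < 1)
    (hη : η ≤ ε / (12 * 8 ^ z)) {f : {x // x ∈ R} → X → ℝ≥0}
    (hf : ∀ (x : {x // x ∈ R}) (y : X),
      dist (x : X) y ≤ f x y ∧ (f x y : ℝ) ≤ (1 + ε / distortion z) * dist (x : X) y)
    (hR : R.Nonempty) (hS : S.Nonempty) (hSR : S ⊆ R) (happ : IsApprox (centerRanges f k) η R S) :
    IsCoreset k z ε (cost z R unitWeight {c}) R S (fun _ => (R.card : ℝ) / S.card) := by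
  refine ⟨hSR, fun C hC hCk => ?_⟩
  have hRc : (0 : ℝ) < R.card := by exact_mod_cast hR.card_pos
  have hSc : (S.card : ℝ) ≠ 0 := by exact_mod_cast hS.card_pos.ne'
  have h8 : (1 : ℝ) ≤ 8 ^ z := Real.one_le_rpow (by norm_num) hz.le
  set d : X → ℝ := fun x => Metric.infDist x C with hd
  -- The sublevel sets of this minimum in `R` are exactly center ranges; the value `0` outside `R`
  -- plays no role.
  set g : X → ℝ := fun x => if hx : x ∈ R then C.inf' hC fun y => (f ⟨x, hx⟩ y : ℝ) else 0 with hg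
  have hd0 : ∀ x ∈ R, 0 ≤ d x := fun x _ => Metric.infDist_nonneg
  have hdd : ∀ x ∈ R, ∀ y ∈ R, d x ≤ d y + 4 * r := by
    intro x hx y hy
    have h1 : d x ≤ d y + dist x y := Metric.infDist_le_infDist_add_dist
    have h2 := dist_triangle_right x y c
    have h3 := (hRing (mem_coe.2 hx)).2
    have h4 := (hRing (mem_coe.2 hy)).2
    linarith
  have hdg : ∀ x ∈ R, d x ≤ g x := by
    intro x hx
    simp only [hg, dif_pos hx, le_inf'_iff]
    exact fun y hy => (Metric.infDist_le_dist_of_mem (mem_coe.2 hy)).trans (hf ⟨x, hx⟩ y).1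
  have hgd : ∀ x ∈ R, g x ≤ (1 + ε / distortion z) * d x := by
    intro x hx
    obtain ⟨y, hy, hxy⟩ := C.finite_toSet.isCompact.exists_infDist_eq_dist hC.to_set x
    simp only [hg, dif_pos hx, hd, hxy]
    exact (inf'_le _ (mem_coe.1 hy)).trans (hf ⟨x, hx⟩ y).2
  have hfrac : ∀ τ : ℝ, 0 ≤ τ → |((R.filter (g · ≤ τ)).card : ℝ) / R.card
      - ((S.filter (g · ≤ τ)).card : ℝ) / S.card| ≤ η := by
    intro τ hτ
    lift τ to ℝ≥0 using hτ
    obtain ⟨A, hA⟩ : ∃ A : Set X, A = {x | ∃ hx : x ∈ R, ∃ y ∈ C, f ⟨x, hx⟩ y ≤ τ} := ⟨_, rfl⟩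
    have h1 := happ A ⟨C, hC, hCk, τ, hA⟩
    have e : ∀ P ⊆ R, P.filter (fun x => g x ≤ τ) = P.filter (· ∈ A) := by
      intro P hP
      refine filter_congr fun x hx => ?_
      simp only [hA, hg, dif_pos (hP hx), inf'_le_iff, Set.mem_ofPred_eq, NNReal.coe_le_coe, hP hx,
        exists_true_left]
    rwa [← e R subset_rfl, ← e S hSR] at h1
  have hmain : |avg R (fun x => d x ^ z) - avg S (fun x => d x ^ z)|
      ≤ ε * (avg R (fun x => d x ^ z) + r ^ z) := by
    rcases le_or_gt z 1 with hz1 | hz1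
    · refine abs_avg_rpow_sub_le_of_le_one hR hS hSR hz hz1 hr hε hε1 (hη.trans ?_) hd0 hdd hdg
        (fun x hx => ?_) hfrac
      · exact div_le_div_of_nonneg_left hε.le (by norm_num) (by linarith)
      · simpa [distortion, hz1] using hgd x hx
    · refine abs_avg_rpow_sub_le hR hS hSR hz hr hε hε1 (hη.trans ?_) hd0 hdd hdg
        (fun x hx => ?_) hfrac
      · exact div_le_div_of_nonneg_left hε.le (by positivity) (by linarith)
      · simpa [distortion, hz1.not_ge] using hgd x hx
  -- The inner radius of the ring turns the error `r ^ z` per point into the cost of `c`.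
  have hc : R.card * r ^ z ≤ cost z R unitWeight {c} := by
    rw [show (unitWeight : X → ℝ) = fun _ => 1 from rfl, cost_const, one_mul]
    refine mul_le_mul_of_nonneg_left (le_avg hR fun x hx => ?_) hRc.le
    rw [coe_singleton, Metric.infDist_singleton]
    exact Real.rpow_le_rpow hr.le (hRing (mem_coe.2 hx)).1.le hz.le
  rw [show cost z R unitWeight C = R.card * avg R (fun x => d x ^ z) by
      rw [show (unitWeight : X → ℝ) = fun _ => 1 from rfl, cost_const, one_mul],
    cost_const, div_mul_cancel₀ _ hSc, ← mul_sub, abs_mul, abs_of_pos hRc]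
  calc (R.card : ℝ) * |avg R (fun x => d x ^ z) - avg S (fun x => d x ^ z)|
      ≤ R.card * (ε * (avg R (fun x => d x ^ z) + r ^ z)) := by gcongr
    _ = ε * (R.card * avg R (fun x => d x ^ z) + R.card * r ^ z) := by ring
    _ ≤ _ := by gcongr

theorem isCoreset_self {k : ℕ} {z ε A : ℝ} (hε : 0 ≤ ε) (hA : 0 ≤ A) (R : Finset X) :
    IsCoreset k z ε A R R (fun _ => (R.card : ℝ) / R.card) := by
  refine ⟨subset_rfl, fun C _ _ => ?_⟩
  have h : cost z R (fun _ => (R.card : ℝ) / R.card) C = cost z R unitWeight C := by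
    refine sum_congr rfl fun x hx => ?_
    have : (R.card : ℝ) ≠ 0 := by exact_mod_cast (card_pos.2 ⟨x, hx⟩).ne'
    rw [div_self this]
    rfl
  have h0 : 0 ≤ cost z R unitWeight C := sum_nonneg fun x _ =>
    mul_nonneg zero_le_one (Real.rpow_nonneg Metric.infDist_nonneg z)
  rw [h, sub_self, abs_zero]
  positivity

end Coreset

theorem uniformSampleProb_card {X : Type*} {R : Finset X} {E : Finset X → Prop} (h : E R) :
    uniformSampleProb R R.card E = 1 := by
  rw [uniformSampleProb, powersetCard_self, filter_singleton, if_pos h]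
  simp

open Classical in
theorem le_uniformSampleProb {X : Type*} {R : Finset X} {m : ℕ} (hm : m ≤ R.card)
    {E G : Finset X → Prop} {δ : ℝ} (hGE : ∀ S ∈ R.powersetCard m, G S → E S)
    (hG : (((R.powersetCard m).filter (fun S => ¬ G S)).card : ℝ) ≤ δ * (R.card.choose m : ℝ)) :
    1 - δ ≤ uniformSampleProb R m E := by
  have hpos : (0 : ℝ) < (R.powersetCard m).card := by
    rw [card_powersetCard]
    exact_mod_cast Nat.choose_pos hm
  rw [uniformSampleProb, le_div_iff₀ hpos]
  have h1 : (((R.powersetCard m).filter G).card : ℝ) ≤ ((R.powersetCard m).filter E).card := by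
    refine Nat.cast_le.2 (card_le_card fun S hS => ?_)
    rw [mem_filter] at hS ⊢
    exact ⟨hS.1, hGE S hS.1 hS.2⟩
  have h2 : (((R.powersetCard m).filter G).card : ℝ)
      + ((R.powersetCard m).filter (fun S => ¬ G S)).card = (R.powersetCard m).card := by
    exact_mod_cast card_filter_add_card_filter_not G
  rw [← card_powersetCard] at hG
  linarith

end UniformCoreset

end

theorem theorem5p2 :
    ∃ p : ℕ, ∀ z : ℝ, 0 < z →
    ∃ A : ℝ, 1 ≤ A ∧ (z ≤ 1 → A = 1) ∧
    ∃ K : ℝ, 0 < K ∧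
    ∀ (X : Type*) [MetricSpace X] (c : X) (r : ℝ), 0 < r →
    ∀ R : Finset X, (R : Set X) ⊆ UniformCoreset.ring c r (2 * r) →
    ∀ ε δ : ℝ, 0 < ε → ε < 1 → 0 < δ → δ < 1 →
    ∀ f : {x // x ∈ R} → X → NNReal,
    (∀ (x : {x // x ∈ R}) (y : X),
      dist (x : X) y ≤ (f x y : ℝ) ∧ (f x y : ℝ) ≤ (1 + ε / A) * dist (x : X) y) →
    ∀ k : ℕ, 1 ≤ k →
    ∀ m : ℕ,
      K * (1 / ε) ^ 2 * Real.log (2 * k * UniformCoreset.sdim (Set.range f) / ε) ^ p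
        * k * Real.log (2 / δ) * UniformCoreset.sdim (Set.range f) ≤ (m : ℝ) →
    1 - δ ≤ UniformCoreset.uniformSampleProb R (min m R.card) (fun S =>
      UniformCoreset.IsCoreset k z ε (UniformCoreset.cost z R UniformCoreset.unitWeight {c})
        R S (fun _ => (R.card : ℝ) / (S.card : ℝ))) := by
  -- A single logarithmic factor suffices.
  refine ⟨1, fun z hz => ⟨UniformCoreset.distortion z, UniformCoreset.one_le_distortion z,
    fun h => if_pos h, ?_⟩⟩
  have h8 : (1 : ℝ) ≤ 8 ^ z := Real.one_le_rpow (by norm_num) hz.le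
  -- Accuracy `ε / q` serves both ranges of `z`; `b = 16 * q ^ 2` turns the exponent `m * (ε / q) ^
  -- 2 / 16` into `m / (b * (1 / ε) ^ 2)`.
  set q : ℝ := 12 * 8 ^ z with hq
  set b : ℝ := 16 * q ^ 2 with hb
  have hb1 : 1 ≤ b := by nlinarith
  have hlogb : 0 ≤ Real.log (8 * b) := Real.log_nonneg (by linarith)
  refine ⟨32 * b * (Real.log (8 * b) + 1), by positivity, ?_⟩
  intro X _ c r hr R hRing ε δ hε hε1 hδ hδ1 f hf k hk m hm
  -- If `|R| ≤ m`, the sample is `R` itself with zero error; this also covers empty `R`.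
  rcases le_or_gt R.card m with hRm | hmR
  · rw [min_eq_right hRm, UniformCoreset.uniformSampleProb_card]
    · linarith
    · exact UniformCoreset.isCoreset_self hε.le (Finset.sum_nonneg fun x _ =>
        mul_nonneg zero_le_one (Real.rpow_nonneg Metric.infDist_nonneg z)) R
  rw [min_eq_left hmR.le]
  have ht := (UniformCoreset.sdim_spec (Set.finite_range f)).1
  have hgrowth := UniformCoreset.hasGrowth_centerRanges (UniformCoreset.injective_of_dist_le hf) k
  set t := UniformCoreset.sdim (Set.range f)
  have hd1 : (1 : ℝ) ≤ ((t * k : ℕ) : ℝ) := by exact_mod_cast Nat.mul_le_mul ht hk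
  obtain ⟨hm8, hsize⟩ := UniformCoreset.sample_size_sufficient (d := ((t * k : ℕ) : ℝ)) hb1 hε hε1
    hδ hδ1 hd1 (m := m) (by
      refine le_trans (le_of_eq ?_) hm
      rw [pow_one, show 2 * ((t * k : ℕ) : ℝ) / ε = 2 * k * t / ε by push_cast; ring]
      push_cast
      ring)
  have hq1 : 1 ≤ q := by linarith
  refine UniformCoreset.le_uniformSampleProb hmR.le
    (G := UniformCoreset.IsApprox (UniformCoreset.centerRanges f k) (ε / q) R) ?_ ?_
  · intro S hS hG
    rw [Finset.mem_powersetCard] at hS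
    have hm0 : 0 < m := by
      have : (0 : ℝ) < m := by linarith
      exact_mod_cast this
    exact UniformCoreset.isCoreset_of_isApprox hz hr hRing hε hε1 le_rfl hf
      (Finset.card_pos.1 (by omega)) (Finset.card_pos.1 (by omega)) hS.1 hG
  · refine UniformCoreset.card_filter_not_isApprox_le_mul hgrowth (by exact_mod_cast hm8) hmR.le
      (by positivity) ?_ hδ hδ1.le ?_
    · rw [div_le_one (by positivity)]
      linarith
    · have h1 : (m : ℝ) * (ε / q) ^ 2 / 16 = m / (b * (1 / ε) ^ 2) := by
        rw [hb]
        field_simp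
      rw [h1, le_div_iff₀ (by positivity), mul_comm]
      exact hsize
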